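/- Let $[n]=\{1,\dots,n\}$, $n\ge 0$. Two blocks $A,B$ of a set partition of $[n]$ \emph{overlap} if $\min A<\min B<\max A<\max B$; a partition is \emph{non-overlapping} if no two of its blocks overlap, and the $n$th Bessel number $B^*_n$ is the number of non-overlapping partitions of $[n]$. Let $S_n(a\text{-}bc,\,ab\text{-}c)$ be the set of permutations $\pi=\pi_1\pi_2\cdots\pi_n$ of $[n]$ that avoid both generalised patterns $a\text{-}bc$ and $ab\text{-}c$, that is, for which there are no indices $i<j$ with $j+1\le n$ and $\pi_i<\pi_j<\pi_{j+1}$, and no indices $i,j$ with $i+1<j\le n$ and $\pi_i<\pi_{i+1}<\pi_j$. For every $n\ge 0$, the non-overlapping partitions of $[n]$ are in one-to-one correspondence with the permutations in $S_n(a\text{-}bc,\,ab\text{-}c)$. Hence $$|S_n(a\text{-}bc,\,ab\text{-}c)|=B^*_n .$$ -/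

import Mathlib

/-- A generalised pattern with `gaps + 1` letters: a word without repeated letters over a linearly
ordered alphabet, together with the information between which adjacent letters there is a dash.
Dashes at the very beginning and the very end of the pattern are implicit. -/
structure GenPattern where
  gaps : ℕ
  letter : Fin (gaps + 1) → ℕ
  letter_injective : Function.Injective letter
  /-- `dash i = true` iff a dash separates the letters number `i` and `i + 1`. -/
  dash : Fin gaps → Bool

namespace GenPattern

/-- The positions `e 0 < e 1 < ⋯` of the word `π 0, π 1, …, π (n - 1)` carry a `p`-subword:
the letters found there are order equivalent to those of `p`, and two letters that are not
separated by a dash in `p` stand at adjacent positions. -/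
def IsOccurrence (p : GenPattern) {n : ℕ} (π : Equiv.Perm (Fin n))
    (e : Fin (p.gaps + 1) → Fin n) : Prop :=
  StrictMono e ∧
  (∀ i j, p.letter i < p.letter j ↔ π (e i) < π (e j)) ∧
  ∀ i : Fin p.gaps, p.dash i = false → (e i.succ : ℕ) = (e i.castSucc : ℕ) + 1

/-- `π` contains no `p`-subword. -/
def Avoids (p : GenPattern) {n : ℕ} (π : Equiv.Perm (Fin n)) : Prop :=
  ¬ ∃ e : Fin (p.gaps + 1) → Fin n, p.IsOccurrence π e

/-- The pattern a-bc, with the letters a, b, c written 0, 1, 2. -/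
def a_bc : GenPattern where
  gaps := 2
  letter := ![0, 1, 2]
  letter_injective := by decide
  dash := ![true, false]

/-- The pattern ab-c, with the letters a, b, c written 0, 1, 2. -/
def ab_c : GenPattern where
  gaps := 2
  letter := ![0, 1, 2]
  letter_injective := by decide
  dash := ![false, true]

end GenPattern

/-- The permutations of an `n`-element chain that avoid every pattern in `P`. -/
def avoiders (n : ℕ) (P : Set GenPattern) : Set (Equiv.Perm (Fin n)) :=
  {π | ∀ p ∈ P, p.Avoids π}

/-- `min A < min B < max A < max B`, for non-empty `A` and `B`. -/
def Overlap {n : ℕ} (A B : Finset (Fin n)) : Prop :=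
  ∃ (hA : A.Nonempty) (hB : B.Nonempty),
    A.min' hA < B.min' hB ∧ B.min' hB < A.max' hA ∧ A.max' hA < B.max' hB

/-- The partitions of an `n`-element chain no two blocks of which overlap. -/
def nonOverlappingPartitions (n : ℕ) : Set (Finpartition (Finset.univ : Finset (Fin n))) :=
  {π | ∀ A ∈ π.parts, ∀ B ∈ π.parts, ¬ Overlap A B}

/-- The `n`-th Bessel number: the number of non-overlapping partitions of an `n`-element chain. -/
noncomputable def besselNumber (n : ℕ) : ℕ :=
  Nat.card (nonOverlappingPartitions n)

/-! Join the least and greatest element of each non-singleton block of a partition by an arc; this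
gives an involution `τ`. Two blocks overlap iff their arcs cross, and one encloses another iff their
arcs nest (`hasOverlap_iff`, `hasEnclosure_iff`). The partitions with arcs `τ` arise by choosing,
for each fixed point, a singleton block or an arc above it. The number of arcs above a point depends
only on the sets of openers and closers, the type of `τ`. Each type contains exactly one
non-crossing and one non-nesting involution, so there are as many partitions without overlap as
without enclosure. Writing blocks by decreasing minimum, each as its minimum followed by its other
elements in decreasing order, identifies all partitions with the `a-bc`-avoiders. Avoiding `ab-c` as
well means that no non-singleton block is enclosed by another (`ListsBlocks.avoids_ab_c_iff`). -/

/-! ### Non-crossing and non-nesting involutions of a given type -/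

/-- Two arcs `{x, τ x}` and `{y, τ y}` of `τ` cross. -/
def HasCrossing {n : ℕ} (τ : Fin n → Fin n) : Prop :=
  ∃ x y, x < y ∧ y < τ x ∧ τ x < τ y

/-- An arc `{y, τ y}` of `τ` lies strictly inside another arc `{x, τ x}`. -/
def HasNesting {n : ℕ} (τ : Fin n → Fin n) : Prop :=
  ∃ x y, x < y ∧ y < τ y ∧ τ y < τ x

/-- `τ` and `σ` have the same openers and the same closers. -/
def SameType {n : ℕ} (τ σ : Fin n → Fin n) : Prop :=
  ∀ x, (x < τ x ↔ x < σ x) ∧ (τ x < x ↔ σ x < x)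

theorem SameType.symm {n : ℕ} {τ σ : Fin n → Fin n} (h : SameType τ σ) : SameType σ τ :=
  fun x => ⟨(h x).1.symm, (h x).2.symm⟩

theorem SameType.trans {n : ℕ} {τ σ ρ : Fin n → Fin n} (h : SameType τ σ) (h' : SameType σ ρ) :
    SameType τ ρ :=
  fun x => ⟨(h x).1.trans (h' x).1, (h x).2.trans (h' x).2⟩

theorem SameType.eq_of_closers {n : ℕ} {τ σ : Fin n → Fin n} (h : SameType τ σ)
    (hτ : Function.Involutive τ) (hσ : Function.Involutive σ)
    (hc : ∀ c, τ c < c → τ c = σ c) : τ = σ := by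
  funext x
  rcases lt_trichotomy (τ x) x with hx | hx | hx
  · exact hc x hx
  · have h1 := (h x).1
    have h2 := (h x).2
    rw [hx] at h1 h2
    simp only [lt_self_iff_false, false_iff, not_lt] at h1 h2
    rw [hx]
    exact le_antisymm h2 h1
  · have h1 := hc (τ x) (by rwa [hτ x])
    rw [hτ x] at h1
    have := hσ (τ x)
    rw [← h1] at this
    exact this.symm

/-- Reading from left to right, each closer must take the greatest opener still free: an opener
skipped by it closes later and makes a crossing. -/
theorem SameType.eq_of_not_hasCrossing {n : ℕ} {τ σ : Fin n → Fin n} (h : SameType τ σ)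
    (hτ : Function.Involutive τ) (hσ : Function.Involutive σ)
    (nτ : ¬ HasCrossing τ) (nσ : ¬ HasCrossing σ) : τ = σ := by
  refine h.eq_of_closers hτ hσ fun c => ?_
  induction c using WellFoundedLT.induction with
  | ind c ih =>
    have key : ∀ τ σ : Fin n → Fin n, SameType τ σ → Function.Involutive τ →
        Function.Involutive σ → ¬ HasCrossing τ → (∀ y < c, τ y < y → τ y = σ y) →
        σ c < c → ¬ τ c < σ c := by
      intro τ σ h hτ hσ nτ ih hc hlt
      have h1 : σ c < τ (σ c) := (h (σ c)).1.2 (by rwa [hσ c])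
      rcases lt_trichotomy (τ (σ c)) c with h2 | h2 | h2
      · have h3 := ih _ h2 (by rwa [hτ])
        rw [hτ] at h3
        exact absurd (hσ.injective h3) (by grind)
      · have := hτ (σ c)
        rw [h2] at this
        exact absurd this hlt.ne
      · exact nτ ⟨τ c, σ c, hlt, by rwa [hτ], by rwa [hτ]⟩
    intro hc
    rcases lt_trichotomy (τ c) (σ c) with h2 | h2 | h2
    · exact absurd h2 (key τ σ h hτ hσ nτ ih ((h c).2.1 hc))
    · exact h2
    · exact absurd h2 (key σ τ h.symm hσ hτ nσ
        (fun y hy hy' => (ih y hy ((h y).2.2 hy')).symm) hc)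

/-- Here each closer must take the least opener still free, since one left open would enclose the
new arc. -/
theorem SameType.eq_of_not_hasNesting {n : ℕ} {τ σ : Fin n → Fin n} (h : SameType τ σ)
    (hτ : Function.Involutive τ) (hσ : Function.Involutive σ)
    (nτ : ¬ HasNesting τ) (nσ : ¬ HasNesting σ) : τ = σ := by
  refine h.eq_of_closers hτ hσ fun c => ?_
  induction c using WellFoundedLT.induction with
  | ind c ih =>
    have key : ∀ τ σ : Fin n → Fin n, SameType τ σ → Function.Involutive τ →
        Function.Involutive σ → ¬ HasNesting σ → (∀ y < c, τ y < y → τ y = σ y) →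
        τ c < c → σ c < c → ¬ τ c < σ c := by
      intro τ σ h hτ hσ nσ ih hc' hc hlt
      have h1 : τ c < σ (τ c) := (h (τ c)).1.1 (by rwa [hτ c])
      rcases lt_trichotomy (σ (τ c)) c with h2 | h2 | h2
      · have h4 : τ (σ (τ c)) < σ (τ c) := (h _).2.2 (by rwa [hσ])
        have h3 := ih _ h2 h4
        rw [hσ] at h3
        exact absurd (hτ.injective h3) h2.ne
      · have := hσ (τ c)
        rw [h2] at this
        exact absurd this hlt.ne'
      · exact nσ ⟨τ c, σ c, hlt, by rwa [hσ], by rwa [hσ]⟩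
    intro hc
    have hc' := (h c).2.1 hc
    rcases lt_trichotomy (τ c) (σ c) with h2 | h2 | h2
    · exact absurd h2 (key τ σ h hτ hσ nσ ih hc hc')
    · exact h2
    · exact absurd h2 (key σ τ h.symm hσ hτ nτ
        (fun y hy hy' => (ih y hy ((h y).2.2 hy')).symm) hc' hc)

/-- Exchanging the closers of two arcs whose openers precede both closers. -/
theorem exists_exchange {n : ℕ} {τ : Fin n → Fin n} (hτ : Function.Involutive τ) {x y : Fin n}
    (hxy : x < y) (hx : y < τ x) (hy : y < τ y) :
    ∃ σ : Fin n → Fin n, Function.Involutive σ ∧ SameType τ σ ∧ (∀ z < x, σ z = τ z) ∧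
      σ x = τ y := by
  have hinj := hτ.injective
  -- Conjugating by the transposition of the two closers keeps `τ` an involution.
  refine ⟨fun z => Equiv.swap (τ x) (τ y) (τ (Equiv.swap (τ x) (τ y) z)), ?_, ?_, ?_, ?_⟩
  · intro z
    simp [hτ _]
  · intro z
    have h1 := hτ x
    have h2 := hτ y
    have h3 := hτ z
    simp only [Equiv.swap_apply_def]
    grind
  · intro z hz
    have h3 := hτ z
    simp only [Equiv.swap_apply_def]
    grind
  · simp only [Equiv.swap_apply_def]
    grind

/-- Take the lexicographically greatest involution of the type: exchanging closers at a crossing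
raises the value at `x` and no earlier one changes. -/
theorem exists_sameType_not_hasCrossing {n : ℕ} {τ : Fin n → Fin n}
    (hτ : Function.Involutive τ) :
    ∃ σ, Function.Involutive σ ∧ SameType τ σ ∧ ¬ HasCrossing σ := by
  obtain ⟨σ, ⟨hσ, hs⟩, hmax⟩ := Set.exists_max_image
    {σ : Fin n → Fin n | Function.Involutive σ ∧ SameType τ σ} toLex (Set.toFinite _)
    ⟨τ, hτ, fun _ => ⟨Iff.rfl, Iff.rfl⟩⟩
  refine ⟨σ, hσ, hs, ?_⟩
  rintro ⟨x, y, hxy, hyx, hlt⟩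
  obtain ⟨ρ, hρ, hs', hz, hx⟩ := exists_exchange hσ hxy hyx (hyx.trans hlt)
  refine not_lt_of_ge (hmax ρ ⟨hρ, hs.trans hs'⟩) ⟨x, fun z h => (hz z h).symm, ?_⟩
  change σ x < ρ x
  rwa [hx]

/-- Dually, take the lexicographically least one: an exchange at a nesting lowers the value at `x`.
-/
theorem exists_sameType_not_hasNesting {n : ℕ} {τ : Fin n → Fin n}
    (hτ : Function.Involutive τ) :
    ∃ σ, Function.Involutive σ ∧ SameType τ σ ∧ ¬ HasNesting σ := by
  obtain ⟨σ, ⟨hσ, hs⟩, hmin⟩ := Set.exists_min_image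
    {σ : Fin n → Fin n | Function.Involutive σ ∧ SameType τ σ} toLex (Set.toFinite _)
    ⟨τ, hτ, fun _ => ⟨Iff.rfl, Iff.rfl⟩⟩
  refine ⟨σ, hσ, hs, ?_⟩
  rintro ⟨x, y, hxy, hy, hlt⟩
  obtain ⟨ρ, hρ, hs', hz, hx⟩ := exists_exchange hσ hxy (hy.trans hlt) hy
  refine not_lt_of_ge (hmin ρ ⟨hρ, hs.trans hs'⟩) ⟨x, fun z h => hz z h, ?_⟩
  change ρ x < σ x
  rwa [hx]

/-! ### Counting the partitions with given arcs -/

/-- The possible minima of the block of `t` in a partition whose non-singleton blocks have the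
arcs of `τ` joining their least and greatest elements. -/
def allowedMin {n : ℕ} (τ : Fin n → Fin n) (t : Fin n) : Finset (Fin n) :=
  {a | (τ t < t → a = τ t) ∧ (t < τ t → a = t) ∧ (τ t = t → a = t ∨ (a < t ∧ t < τ a))}

/-- An opener before `t` closes either after `t` or before it, and the latter are counted by their
closers. Hence the number of arcs above `t` depends only on the type. -/
theorem card_arcs_over {n : ℕ} {τ : Fin n → Fin n} (hτ : Function.Involutive τ) {t : Fin n}
    (ht : τ t = t) :
    (Finset.univ.filter fun x => x < t ∧ t < τ x).card +
      (Finset.univ.filter fun x => x < t ∧ τ x < x).card =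
      (Finset.univ.filter fun x => x < t ∧ x < τ x).card := by
  have h1 : (Finset.univ.filter fun x => x < t ∧ τ x < x).card =
      (Finset.univ.filter fun x => x < τ x ∧ τ x < t).card := by
    refine Finset.card_nbij' τ τ ?_ ?_ ?_ ?_
    · intro x
      simp only [Finset.coe_filter, Finset.mem_univ, true_and, Set.mem_ofPred_eq, hτ x]
      exact fun h => ⟨h.2, h.1⟩
    · intro x
      simp only [Finset.coe_filter, Finset.mem_univ, true_and, Set.mem_ofPred_eq, hτ x]
      exact fun h => ⟨h.2, h.1⟩
    · exact fun x _ => hτ x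
    · exact fun x _ => hτ x
  rw [h1, ← Finset.card_union_of_disjoint]
  · congr 1
    ext x
    have := hτ x
    simp only [Finset.mem_union, Finset.mem_filter, Finset.mem_univ, true_and]
    grind
  · rw [Finset.disjoint_filter]
    intro x _ h h'
    exact absurd h.2 h'.2.not_gt

theorem card_allowedMin_of_fixed {n : ℕ} {τ : Fin n → Fin n} {t : Fin n} (ht : τ t = t) :
    (allowedMin τ t).card = (Finset.univ.filter fun x => x < t ∧ t < τ x).card + 1 := by
  have : allowedMin τ t = insert t (Finset.univ.filter fun x => x < t ∧ t < τ x) := by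
    ext a
    simp [allowedMin, ht]
  rw [this, Finset.card_insert_of_notMem (by simp)]

theorem card_allowedMin_of_ne {n : ℕ} {τ : Fin n → Fin n} {t : Fin n} (ht : τ t ≠ t) :
    (allowedMin τ t).card = 1 := by
  rw [Finset.card_eq_one]
  refine ⟨min t (τ t), ?_⟩
  ext a
  simp only [allowedMin, Finset.mem_filter, Finset.mem_univ, true_and, Finset.mem_singleton]
  grind

theorem SameType.card_allowedMin {n : ℕ} {τ σ : Fin n → Fin n} (h : SameType τ σ)
    (hτ : Function.Involutive τ) (hσ : Function.Involutive σ) (t : Fin n) :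
    (allowedMin τ t).card = (allowedMin σ t).card := by
  have ht := h t
  by_cases hf : τ t = t
  · have hf' : σ t = t := by grind
    rw [card_allowedMin_of_fixed hf, card_allowedMin_of_fixed hf']
    have h1 := card_arcs_over hτ hf
    have h2 := card_arcs_over hσ hf'
    have h3 : (Finset.univ.filter fun x => x < t ∧ τ x < x) =
        (Finset.univ.filter fun x => x < t ∧ σ x < x) :=
      Finset.filter_congr fun x _ => and_congr_right fun _ => (h x).2
    have h4 : (Finset.univ.filter fun x => x < t ∧ x < τ x) =
        (Finset.univ.filter fun x => x < t ∧ x < σ x) :=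
      Finset.filter_congr fun x _ => and_congr_right fun _ => (h x).1
    rw [h3, h4] at h1
    omega
  · have hf' : σ t ≠ t := by grind
    rw [card_allowedMin_of_ne hf, card_allowedMin_of_ne hf']

open Classical in
/-- The weighted numbers of non-crossing and of non-nesting involutions agree. -/
theorem sum_not_hasCrossing_eq_sum_not_hasNesting (n : ℕ) :
    ∑ τ : Fin n → Fin n with Function.Involutive τ ∧ ¬ HasCrossing τ,
        ∏ t, (allowedMin τ t).card =
      ∑ τ : Fin n → Fin n with Function.Involutive τ ∧ ¬ HasNesting τ,
        ∏ t, (allowedMin τ t).card := by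
  have hN : ∀ τ : Fin n → Fin n, ∃ σ : Fin n → Fin n, Function.Involutive τ →
      Function.Involutive σ ∧ SameType τ σ ∧ ¬ HasNesting σ := fun τ => by
    by_cases hτ : Function.Involutive τ
    · obtain ⟨σ, hσ⟩ := exists_sameType_not_hasNesting hτ
      exact ⟨σ, fun _ => hσ⟩
    · exact ⟨τ, fun h => absurd h hτ⟩
  choose f hf using hN
  refine Finset.sum_bij (fun τ _ => f τ) ?_ ?_ ?_ ?_
  · intro τ hτ
    simp only [Finset.mem_filter, Finset.mem_univ, true_and] at hτ ⊢
    exact ⟨(hf τ hτ.1).1, (hf τ hτ.1).2.2⟩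
  · intro τ hτ σ hσ heq
    simp only [Finset.mem_filter, Finset.mem_univ, true_and] at hτ hσ
    refine SameType.eq_of_not_hasCrossing ?_ hτ.1 hσ.1 hτ.2 hσ.2
    refine (hf τ hτ.1).2.1.trans ?_
    rw [heq]
    exact (hf σ hσ.1).2.1.symm
  · intro σ hσ
    simp only [Finset.mem_filter, Finset.mem_univ, true_and] at hσ
    obtain ⟨τ, hτ, hs, hc⟩ := exists_sameType_not_hasCrossing hσ.1
    refine ⟨τ, by simp [hτ, hc], ?_⟩
    have := hf τ hτ
    exact (hs.trans this.2.1).symm.eq_of_not_hasNesting this.1 hσ.1 this.2.2 hσ.2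
  · intro τ hτ
    simp only [Finset.mem_filter, Finset.mem_univ, true_and] at hτ
    have := hf τ hτ.1
    exact Finset.prod_congr rfl fun t _ => this.2.1.card_allowedMin hτ.1 this.1 t

/-! ### Partitions as maps to block minima, and their arcs -/

/-- `r` sends every element to the least element of its block, for some partition. -/
def IsMinMap {n : ℕ} (r : Fin n → Fin n) : Prop :=
  ∀ i, r i ≤ i ∧ r (r i) = r i

/-- `u` is the greatest element of a block that is overlapped by the block of `v`. -/
def HasOverlap {n : ℕ} (r : Fin n → Fin n) : Prop :=
  ∃ u v, r u < r v ∧ r v < u ∧ u < v ∧ ∀ w, r w = r u → w ≤ u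

/-- `v` is the greatest element of a non-singleton block that is enclosed by the block of `u`. -/
def HasEnclosure {n : ℕ} (r : Fin n → Fin n) : Prop :=
  ∃ u v, r u < r v ∧ r v < v ∧ v < u ∧ ∀ w, r w = r v → w ≤ v

theorem mem_piFinset_allowedMin {n : ℕ} {τ r : Fin n → Fin n} :
    r ∈ Fintype.piFinset (allowedMin τ) ↔ ∀ t, (τ t < t → r t = τ t) ∧ (t < τ t → r t = t) ∧
      (τ t = t → r t = t ∨ (r t < t ∧ t < τ (r t))) := by
  simp [Fintype.mem_piFinset, allowedMin]

theorem isMinMap_of_mem_piFinset {n : ℕ} {τ r : Fin n → Fin n} (hτ : Function.Involutive τ)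
    (h : r ∈ Fintype.piFinset (allowedMin τ)) : IsMinMap r := by
  rw [mem_piFinset_allowedMin] at h
  intro t
  have h1 := h t
  have h2 := h (r t)
  have h3 := hτ t
  grind

/-- Identifies `τ (r t)` as the greatest element of the block of `t`. -/
theorem le_arc_end {n : ℕ} {τ r : Fin n → Fin n} (hτ : Function.Involutive τ)
    (h : r ∈ Fintype.piFinset (allowedMin τ)) (t : Fin n) :
    t ≤ τ (r t) ∧ r (τ (r t)) = r t := by
  rw [mem_piFinset_allowedMin] at h
  have h1 := h t
  have h2 := h (r t)
  have h3 := hτ t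
  have h4 := h (τ (r t))
  have h5 := hτ (r t)
  grind

theorem hasOverlap_iff {n : ℕ} {τ r : Fin n → Fin n} (hτ : Function.Involutive τ)
    (h : r ∈ Fintype.piFinset (allowedMin τ)) : HasOverlap r ↔ HasCrossing τ := by
  have hle := le_arc_end hτ h
  have hm := mem_piFinset_allowedMin.1 h
  constructor
  · rintro ⟨u, v, h1, h2, h3, h4⟩
    have hu : τ (r u) = u := le_antisymm (h4 _ (hle u).2) (hle u).1
    -- `v` need not be the maximum of its block; passing to `τ (r v)` only moves the right end
    -- further right.
    exact ⟨r u, r v, h1, by rwa [hu], by rw [hu]; exact h3.trans_le (hle v).1⟩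
  · rintro ⟨x, y, h1, h2, h3⟩
    have hx : r (τ x) = x := by
      have := (hm (τ x)).1
      rw [hτ] at this
      exact this (h1.trans h2)
    have hy : r (τ y) = y := by
      have := (hm (τ y)).1
      rw [hτ] at this
      exact this (h2.trans h3)
    refine ⟨τ x, τ y, by rwa [hx, hy], by rwa [hy], h3, fun w hw => ?_⟩
    rw [hx] at hw
    rw [← hw]
    exact (hle w).1

theorem hasEnclosure_iff {n : ℕ} {τ r : Fin n → Fin n} (hτ : Function.Involutive τ)
    (h : r ∈ Fintype.piFinset (allowedMin τ)) : HasEnclosure r ↔ HasNesting τ := by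
  have hle := le_arc_end hτ h
  have hm := mem_piFinset_allowedMin.1 h
  constructor
  · rintro ⟨u, v, h1, h2, h3, h4⟩
    have hv : τ (r v) = v := le_antisymm (h4 _ (hle v).2) (hle v).1
    exact ⟨r u, r v, h1, by rwa [hv], by rw [hv]; exact h3.trans_le (hle u).1⟩
  · rintro ⟨x, y, h1, h2, h3⟩
    have hx : r (τ x) = x := by
      have := (hm (τ x)).1
      rw [hτ] at this
      exact this (h1.trans (h2.trans h3))
    have hy : r (τ y) = y := by
      have := (hm (τ y)).1
      rw [hτ] at this
      exact this h2
    refine ⟨τ x, τ y, by rwa [hx, hy], by rwa [hy], h3, fun w hw => ?_⟩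
    rw [hy] at hw
    rw [← hw]
    exact (hle w).1

/-- At block minima both involutions return the block maximum, which fixes all arcs. -/
theorem arcs_unique {n : ℕ} {τ σ r : Fin n → Fin n} (hτ : Function.Involutive τ)
    (hσ : Function.Involutive σ) (h : r ∈ Fintype.piFinset (allowedMin τ))
    (h' : r ∈ Fintype.piFinset (allowedMin σ)) : τ = σ := by
  have hr := isMinMap_of_mem_piFinset hτ h
  have key : ∀ t, τ (r t) = σ (r t) := by
    intro t
    have h1 := le_arc_end hτ h
    have h2 := le_arc_end hσ h'
    have h3 := (h1 (σ (r t))).1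
    have h4 := (h2 (τ (r t))).1
    rw [(h2 t).2] at h3
    rw [(h1 t).2] at h4
    exact le_antisymm h4 h3
  rw [mem_piFinset_allowedMin] at h h'
  funext t
  have h1 := h t
  have h2 := h' t
  have h3 := key t
  have h4 := hτ t
  have h5 := hσ t
  have h6 := hr t
  have h7 := hτ (r t)
  grind

theorem exists_arcs {n : ℕ} {r : Fin n → Fin n} (hr : IsMinMap r) :
    ∃ τ, Function.Involutive τ ∧ r ∈ Fintype.piFinset (allowedMin τ) := by
  have hM : ∀ a, ∃ m, r a = a → r m = a ∧ ∀ w, r w = a → w ≤ m := by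
    intro a
    by_cases ha : r a = a
    · obtain ⟨m, hm, hmax⟩ := Set.exists_max_image {w | r w = a} id (Set.toFinite _) ⟨a, ha⟩
      exact ⟨m, fun _ => ⟨hm, hmax⟩⟩
    · exact ⟨a, fun h => absurd h ha⟩
  choose M hM using hM
  -- Minimum and maximum of each block are exchanged; singletons and interior elements stay fixed.
  refine ⟨fun v => if r v = v then M v else if M (r v) = v then r v else v, ?_, ?_⟩
  · intro v
    have h1 := hr v
    have h2 := hM v
    have h3 := hM (r v)
    grind
  · rw [mem_piFinset_allowedMin]
    intro v
    have h1 := hr v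
    have h2 := hM v
    have h3 := hM (r v)
    grind

open Classical in
-- For a property that depends only on the arcs, the partitions split into disjoint product sets,
-- one for each `τ`.
theorem card_isMinMap_eq_sum {n : ℕ} (Q Q' : (Fin n → Fin n) → Prop)
    (hQ : ∀ τ r, Function.Involutive τ → r ∈ Fintype.piFinset (allowedMin τ) → (Q r ↔ Q' τ)) :
    Nat.card {r : Fin n → Fin n // IsMinMap r ∧ ¬ Q r} =
      ∑ τ : Fin n → Fin n with Function.Involutive τ ∧ ¬ Q' τ, ∏ t, (allowedMin τ t).card := by
  have : (Finset.univ.filter fun r : Fin n → Fin n => IsMinMap r ∧ ¬ Q r) =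
      (Finset.univ.filter fun τ : Fin n → Fin n => Function.Involutive τ ∧ ¬ Q' τ).biUnion
        fun τ => Fintype.piFinset (allowedMin τ) := by
    ext r
    simp only [Finset.mem_filter, Finset.mem_univ, true_and, Finset.mem_biUnion]
    constructor
    · rintro ⟨hr, hq⟩
      obtain ⟨τ, hτ, h⟩ := exists_arcs hr
      exact ⟨τ, ⟨hτ, fun h' => hq ((hQ τ r hτ h).2 h')⟩, h⟩
    · rintro ⟨τ, ⟨hτ, hq⟩, h⟩
      exact ⟨isMinMap_of_mem_piFinset hτ h, fun h' => hq ((hQ τ r hτ h).1 h')⟩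
  rw [Nat.card_eq_fintype_card, Fintype.card_subtype, this, Finset.card_biUnion]
  · exact Finset.sum_congr rfl fun τ _ => Fintype.card_piFinset _
  · intro τ hτ σ hσ hne
    have hτ := (Finset.mem_filter.1 hτ).2
    have hσ := (Finset.mem_filter.1 hσ).2
    rw [Function.onFun, Finset.disjoint_left]
    exact fun r h h' => hne (arcs_unique hτ.1 hσ.1 h h')

theorem card_not_hasOverlap_eq_card_not_hasEnclosure (n : ℕ) :
    Nat.card {r : Fin n → Fin n // IsMinMap r ∧ ¬ HasOverlap r} =
      Nat.card {r : Fin n → Fin n // IsMinMap r ∧ ¬ HasEnclosure r} := by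
  rw [card_isMinMap_eq_sum _ HasCrossing fun τ r hτ h => hasOverlap_iff hτ h,
    card_isMinMap_eq_sum _ HasNesting fun τ r hτ h => hasEnclosure_iff hτ h]
  exact sum_not_hasCrossing_eq_sum_not_hasNesting n

/-! ### From `Finpartition` to maps of minima -/

/-- The least element of the block of `i`. -/
def blockMin {n : ℕ} (P : Finpartition (Finset.univ : Finset (Fin n))) (i : Fin n) : Fin n :=
  (P.part i).min' ⟨i, P.mem_part (Finset.mem_univ i)⟩

theorem blockMin_mem {n : ℕ} (P : Finpartition (Finset.univ : Finset (Fin n))) (i : Fin n) :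
    blockMin P i ∈ P.part i :=
  Finset.min'_mem _ _

theorem blockMin_le {n : ℕ} (P : Finpartition (Finset.univ : Finset (Fin n))) {i j : Fin n}
    (h : j ∈ P.part i) : blockMin P i ≤ j :=
  Finset.min'_le _ _ h

theorem part_eq_of_mem_part {n : ℕ} (P : Finpartition (Finset.univ : Finset (Fin n)))
    {i j : Fin n} (h : j ∈ P.part i) : P.part j = P.part i :=
  P.part_eq_of_mem (P.part_mem.2 (Finset.mem_univ i)) h

theorem blockMin_eq_iff {n : ℕ} (P : Finpartition (Finset.univ : Finset (Fin n)))
    (i j : Fin n) : blockMin P j = blockMin P i ↔ j ∈ P.part i := by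
  constructor
  · intro h
    have h1 := part_eq_of_mem_part P (blockMin_mem P j)
    have h2 := part_eq_of_mem_part P (blockMin_mem P i)
    rw [← h2, ← h, h1]
    exact P.mem_part (Finset.mem_univ j)
  · intro h
    simp only [blockMin, part_eq_of_mem_part P h]

theorem isMinMap_blockMin {n : ℕ} (P : Finpartition (Finset.univ : Finset (Fin n))) :
    IsMinMap (blockMin P) :=
  fun i => ⟨blockMin_le P (P.mem_part (Finset.mem_univ i)),
    (blockMin_eq_iff P _ _).2 (blockMin_mem P i)⟩

theorem mem_nonOverlappingPartitions_iff {n : ℕ}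
    (P : Finpartition (Finset.univ : Finset (Fin n))) :
    P ∈ nonOverlappingPartitions n ↔ ¬ HasOverlap (blockMin P) := by
  rw [← not_iff_not, not_not]
  simp only [nonOverlappingPartitions, Set.mem_ofPred_eq, not_forall, not_not]
  constructor
  · rintro ⟨A, hA, B, hB, nA, nB, h1, h2, h3⟩
    have eA : P.part (A.max' nA) = A := P.part_eq_of_mem hA (A.max'_mem nA)
    have eB : P.part (B.max' nB) = B := P.part_eq_of_mem hB (B.max'_mem nB)
    have mA : blockMin P (A.max' nA) = A.min' nA := by simp only [blockMin, eA]
    have mB : blockMin P (B.max' nB) = B.min' nB := by simp only [blockMin, eB]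
    refine ⟨A.max' nA, B.max' nB, by rwa [mA, mB], by rwa [mB], h3, fun w hw => ?_⟩
    rw [blockMin_eq_iff, eA] at hw
    exact A.le_max' w hw
  · rintro ⟨u, v, h1, h2, h3, h4⟩
    have hu := P.mem_part (Finset.mem_univ u)
    have hv := P.mem_part (Finset.mem_univ v)
    have hmax : (P.part u).max' ⟨u, hu⟩ = u :=
      le_antisymm (h4 _ ((blockMin_eq_iff P _ _).2 (Finset.max'_mem _ _)))
        (Finset.le_max' _ _ hu)
    refine ⟨P.part u, P.part_mem.2 (Finset.mem_univ u), P.part v,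
      P.part_mem.2 (Finset.mem_univ v), ⟨u, hu⟩, ⟨v, hv⟩, h1, ?_, ?_⟩
    · rw [hmax]
      exact h2
    · rw [hmax]
      exact h3.trans_le (Finset.le_max' _ _ hv)

theorem blockMin_injective (n : ℕ) :
    Function.Injective (blockMin : Finpartition (Finset.univ : Finset (Fin n)) → _) := by
  intro P Q h
  have hp : ∀ i, P.part i = Q.part i := fun i => by
    ext j
    rw [← blockMin_eq_iff, ← blockMin_eq_iff, h]
  have hsub : ∀ P Q : Finpartition (Finset.univ : Finset (Fin n)),
      (∀ i, P.part i = Q.part i) → P.parts ⊆ Q.parts := by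
    intro P Q hp A hA
    obtain ⟨i, hi⟩ := P.nonempty_of_mem_parts hA
    rw [← P.part_eq_of_mem hA hi, hp i]
    exact Q.part_mem.2 (Finset.mem_univ i)
  exact Finpartition.ext (Finset.Subset.antisymm (hsub P Q hp) (hsub Q P fun i => (hp i).symm))

theorem exists_blockMin_eq {n : ℕ} {r : Fin n → Fin n} (hr : IsMinMap r) :
    ∃ P : Finpartition (Finset.univ : Finset (Fin n)), blockMin P = r := by
  classical
  refine ⟨Finpartition.ofSetoid (Setoid.ker r), ?_⟩
  funext i
  have hm : ∀ j, j ∈ (Finpartition.ofSetoid (Setoid.ker r)).part i ↔ r j = r i := fun j => by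
    rw [Finpartition.mem_part_ofSetoid_iff_rel, Setoid.ker_def]
    exact eq_comm
  refine le_antisymm (blockMin_le _ ((hm _).2 (hr i).2)) ?_
  rw [← (hm _).1 (blockMin_mem _ i)]
  exact (hr _).1

theorem besselNumber_eq (n : ℕ) :
    besselNumber n = Nat.card {r : Fin n → Fin n // IsMinMap r ∧ ¬ HasOverlap r} := by
  refine Nat.card_eq_of_bijective (fun P : nonOverlappingPartitions n =>
    (⟨blockMin P.1, isMinMap_blockMin P.1, (mem_nonOverlappingPartitions_iff P.1).1 P.2⟩ :
      {r : Fin n → Fin n // IsMinMap r ∧ ¬ HasOverlap r})) ⟨?_, ?_⟩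
  · intro P Q h
    exact Subtype.ext (blockMin_injective n (congrArg Subtype.val h))
  · rintro ⟨r, hr, ho⟩
    obtain ⟨P, rfl⟩ := exists_blockMin_eq hr
    exact ⟨⟨P, (mem_nonOverlappingPartitions_iff P).2 ho⟩, rfl⟩

/-! ### Permutations listing the blocks of a partition -/

/-- Listing the elements by decreasing key writes the blocks in decreasing order of their least
elements, each block with its least element first and the other elements in decreasing order. -/
def blockKey {n : ℕ} (r : Fin n → Fin n) (v : Fin n) : ℕ :=
  -- The second summand is below `n + 1`, so keys compare lexicographically; `n` exceeds every
  -- element and puts the minimum first in its block.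
  (r v : ℕ) * (n + 1) + if r v = v then n else (v : ℕ)

theorem blockKey_lt_iff {n : ℕ} (r : Fin n → Fin n) (u v : Fin n) :
    blockKey r u < blockKey r v ↔ r u < r v ∨ (r u = r v ∧ r u ≠ u ∧ (r v = v ∨ u < v)) := by
  have hs : ∀ w : Fin n, (if r w = w then n else (w : ℕ)) < n + 1 := fun w => by
    have := w.2
    split_ifs <;> omega
  have hu := hs u
  have hv := hs v
  unfold blockKey
  rcases lt_trichotomy (r u) (r v) with h | h | h
  · have h' : (r u : ℕ) + 1 ≤ (r v : ℕ) := h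
    have := Nat.mul_le_mul_right (n + 1) h'
    simp only [h, true_or, iff_true]
    rw [add_mul] at this
    omega
  · simp only [h, lt_self_iff_false, false_or, true_and, add_lt_add_iff_left]
    have hun := u.2
    have hvn := v.2
    rw [Fin.lt_def]
    split_ifs with h1 h2 h2 <;> grind
  · have h' : (r v : ℕ) + 1 ≤ (r u : ℕ) := h
    have := Nat.mul_le_mul_right (n + 1) h'
    rw [add_mul] at this
    simp only [h.not_gt, h.ne', false_and, or_self, iff_false]
    omega

theorem blockKey_injective {n : ℕ} (r : Fin n → Fin n) : Function.Injective (blockKey r) := by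
  intro u v h
  have h1 := blockKey_lt_iff r u v
  have h2 := blockKey_lt_iff r v u
  rw [h] at h1 h2
  grind

theorem avoids_a_bc_iff {n : ℕ} (π : Equiv.Perm (Fin n)) :
    GenPattern.a_bc.Avoids π ↔
      ∀ i j k : Fin n, i < j → (k : ℕ) = j + 1 → ¬ (π i < π j ∧ π j < π k) := by
  constructor
  · rintro h i j k hij hk ⟨h1, h2⟩
    refine h ⟨(![i, j, k] : Fin 3 → Fin n), ?_, ?_, ?_⟩
    · have hjk : j < k := by rw [Fin.lt_def]; omega
      refine Fin.strictMono_iff_lt_succ.2 fun (l : Fin 2) => ?_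
      fin_cases l
      · exact hij
      · exact hjk
    · intro (a : Fin 3) (b : Fin 3)
      have h3 := h1.trans h2
      fin_cases a <;> fin_cases b <;>
        simp [GenPattern.a_bc, h1, h2, h3, h1.le, h2.le, h3.le]
    · intro (l : Fin 2) hl
      fin_cases l
      · simp [GenPattern.a_bc] at hl
      · exact hk
  · rintro h ⟨(e : Fin 3 → Fin n), he, ho, hd⟩
    refine h (e 0) (e 1) (e 2) (he (by decide : (0 : Fin 3) < 1)) (hd (1 : Fin 2) rfl) ⟨?_, ?_⟩
    · exact (ho (0 : Fin 3) (1 : Fin 3)).1 (by decide)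
    · exact (ho (1 : Fin 3) (2 : Fin 3)).1 (by decide)

theorem avoids_ab_c_iff {n : ℕ} (π : Equiv.Perm (Fin n)) :
    GenPattern.ab_c.Avoids π ↔
      ∀ i j k : Fin n, (j : ℕ) = i + 1 → j < k → ¬ (π i < π j ∧ π j < π k) := by
  constructor
  · rintro h i j k hj hjk ⟨h1, h2⟩
    refine h ⟨(![i, j, k] : Fin 3 → Fin n), ?_, ?_, ?_⟩
    · have hij : i < j := by rw [Fin.lt_def]; omega
      refine Fin.strictMono_iff_lt_succ.2 fun (l : Fin 2) => ?_
      fin_cases l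
      · exact hij
      · exact hjk
    · intro (a : Fin 3) (b : Fin 3)
      have h3 := h1.trans h2
      fin_cases a <;> fin_cases b <;>
        simp [GenPattern.ab_c, h1, h2, h3, h1.le, h2.le, h3.le]
    · intro (l : Fin 2) hl
      fin_cases l
      · exact hj
      · simp [GenPattern.ab_c] at hl
  · rintro h ⟨(e : Fin 3 → Fin n), he, ho, hd⟩
    refine h (e 0) (e 1) (e 2) (hd (0 : Fin 2) rfl) (he (by decide : (1 : Fin 3) < 2)) ⟨?_, ?_⟩
    · exact (ho (0 : Fin 3) (1 : Fin 3)).1 (by decide)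
    · exact (ho (1 : Fin 3) (2 : Fin 3)).1 (by decide)

theorem mem_avoiders_iff {n : ℕ} (π : Equiv.Perm (Fin n)) :
    π ∈ avoiders n {GenPattern.a_bc, GenPattern.ab_c} ↔
      GenPattern.a_bc.Avoids π ∧ GenPattern.ab_c.Avoids π := by
  simp [avoiders]

/-- `π` lists the blocks of `r` in the order of decreasing keys. -/
def ListsBlocks {n : ℕ} (π : Equiv.Perm (Fin n)) (r : Fin n → Fin n) : Prop :=
  StrictAnti (blockKey r ∘ π)

theorem ListsBlocks.symm_lt_iff {n : ℕ} {π : Equiv.Perm (Fin n)} {r : Fin n → Fin n} (h : ListsBlocks π r)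
    (u v : Fin n) : π.symm u < π.symm v ↔ blockKey r v < blockKey r u := by
  have := StrictAnti.lt_iff_gt h (a := π.symm v) (b := π.symm u)
  simpa using this.symm

theorem ListsBlocks.lt_iff {n : ℕ} {π : Equiv.Perm (Fin n)} {r : Fin n → Fin n} (h : ListsBlocks π r)
    {i j : Fin n} : blockKey r (π j) < blockKey r (π i) ↔ i < j :=
  StrictAnti.lt_iff_gt h

theorem ListsBlocks.exists_lists {n : ℕ} (r : Fin n → Fin n) : ∃ π : Equiv.Perm (Fin n), ListsBlocks π r := by
  let f : Fin n → ℕᵒᵈ := fun v => OrderDual.toDual (blockKey r v)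
  have hf : Function.Injective f := fun u v h => blockKey_injective r h
  have hm : StrictMono (f ∘ Tuple.sort f) :=
    (Tuple.monotone_sort f).strictMono_of_injective (hf.comp (Tuple.sort f).injective)
  exact ⟨Tuple.sort f, fun i j h => hm h⟩

theorem ListsBlocks.perm_unique {n : ℕ} {π ρ : Equiv.Perm (Fin n)} {r : Fin n → Fin n}
    (h : ListsBlocks π r) (h' : ListsBlocks ρ r) : π = ρ := by
  have hm : StrictMono (π.symm ∘ ρ) := fun i j hij => by
    simp only [Function.comp_apply]
    rw [h.symm_lt_iff]
    exact h' hij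
  have hid : (π.symm ∘ ρ) = id := by
    refine (StrictMono.range_inj hm strictMono_id).1 ?_
    rw [Set.range_id, Set.range_eq_univ]
    exact π.symm.surjective.comp ρ.surjective
  ext i
  have := congrFun hid i
  simp only [Function.comp_apply, id_eq, Equiv.symm_apply_eq] at this
  rw [this]

theorem blockKey_le_blockKey_min {n : ℕ} {r : Fin n → Fin n} (hr : IsMinMap r) (v : Fin n) :
    blockKey r v ≤ blockKey r (r v) := by
  by_contra! h
  rw [blockKey_lt_iff] at h
  have := hr v
  grind

/-- Recovers `r` from `π`: blocks listed earlier have larger minima, so `r v` is the running minimum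
at `v`. -/
theorem ListsBlocks.isLeast {n : ℕ} {π : Equiv.Perm (Fin n)} {r : Fin n → Fin n} (h : ListsBlocks π r)
    (hr : IsMinMap r) (v : Fin n) : IsLeast {w | π.symm w ≤ π.symm v} (r v) := by
  constructor
  · rw [Set.mem_ofPred_eq, ← not_lt, h.symm_lt_iff, not_lt]
    exact blockKey_le_blockKey_min hr v
  · intro w hw
    rw [Set.mem_ofPred_eq, ← not_lt, h.symm_lt_iff, blockKey_lt_iff] at hw
    have := (hr w).1
    by_contra! h'
    exact hw (Or.inl (this.trans_lt h'))

theorem ListsBlocks.map_unique {n : ℕ} {π : Equiv.Perm (Fin n)} {r s : Fin n → Fin n}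
    (h : ListsBlocks π r) (h' : ListsBlocks π s) (hr : IsMinMap r) (hs : IsMinMap s) : r = s :=
  funext fun v => (h.isLeast hr v).unique (h'.isLeast hs v)

/-- Of two adjacent letters in different blocks, the second is the least of its block. -/
theorem ListsBlocks.eq_min_of_adjacent {n : ℕ} {π : Equiv.Perm (Fin n)} {r : Fin n → Fin n}
    (h : ListsBlocks π r) (hr : IsMinMap r) {i j : Fin n} (hij : (j : ℕ) = i + 1)
    (hlt : r (π j) < r (π i)) : r (π j) = π j := by
  have h1 : blockKey r (r (π j)) < blockKey r (π i) := by
    rw [blockKey_lt_iff, (hr _).2]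
    exact Or.inl hlt
  have h2 := blockKey_le_blockKey_min hr (π j)
  have h3 : i < π.symm (r (π j)) := by
    rw [← π.symm_apply_apply i, h.symm_lt_iff]
    simpa using h1
  have h4 : π.symm (r (π j)) ≤ j := by
    rw [← not_lt, ← π.symm_apply_apply j, h.symm_lt_iff, not_lt]
    simpa using h2
  have h5 : π.symm (r (π j)) = j := by
    rw [Fin.lt_def] at h3
    rw [Fin.le_def] at h4
    ext
    omega
  rw [Equiv.symm_apply_eq] at h5
  exact h5

/-- An ascent occurs only directly after a block minimum, and every earlier letter is larger than
that minimum. -/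
theorem ListsBlocks.avoids_a_bc {n : ℕ} {π : Equiv.Perm (Fin n)} {r : Fin n → Fin n}
    (h : ListsBlocks π r) (hr : IsMinMap r) : GenPattern.a_bc.Avoids π := by
  rw [avoids_a_bc_iff]
  rintro i j k hij hk ⟨h1, h2⟩
  have hjk : j < k := by rw [Fin.lt_def]; omega
  have h3 := h.lt_iff.2 hij
  have h4 := h.lt_iff.2 hjk
  rw [blockKey_lt_iff] at h3 h4
  have h5 := h.eq_min_of_adjacent hr hk
  have h6 := hr (π i)
  have h7 := hr (π j)
  grind

/-- An ascent consists of the minimum and maximum of one block; a larger letter further right lies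
in a block with smaller minimum, which encloses it. -/
theorem ListsBlocks.avoids_ab_c_iff {n : ℕ} {π : Equiv.Perm (Fin n)} {r : Fin n → Fin n}
    (h : ListsBlocks π r) (hr : IsMinMap r) : GenPattern.ab_c.Avoids π ↔ ¬ HasEnclosure r := by
  rw [_root_.avoids_ab_c_iff]
  constructor
  · rintro ha ⟨u, v, h1, h2, h3, h4⟩
    have hv := hr v
    have k1 : π.symm (r v) < π.symm v := by
      rw [h.symm_lt_iff, blockKey_lt_iff]
      grind
    have k2 : π.symm v < π.symm u := by
      rw [h.symm_lt_iff, blockKey_lt_iff]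
      exact Or.inl h1
    -- A letter strictly between them would be an element of the same block above its maximum `v`.
    have k3 : (π.symm v : ℕ) = π.symm (r v) + 1 := by
      by_contra hne
      rw [Fin.lt_def] at k1
      have hlt : (π.symm (r v) : ℕ) + 1 < n := by
        have := (π.symm v).2
        omega
      let w := π ⟨(π.symm (r v) : ℕ) + 1, hlt⟩
      have hw : (π.symm w : ℕ) = (π.symm (r v) : ℕ) + 1 := by simp [w]
      have w1 : π.symm (r v) < π.symm w := by rw [Fin.lt_def]; omega
      have w2 : π.symm w < π.symm v := by rw [Fin.lt_def]; omega
      rw [h.symm_lt_iff, blockKey_lt_iff] at w1 w2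
      have := h4 w
      have := hr w
      grind
    exact ha _ _ _ k3 k2 ⟨by simpa using h2, by simpa using h3⟩
  · rintro he i j k hj hjk ⟨h1, h2⟩
    have hij : i < j := by rw [Fin.lt_def]; omega
    have h3 := h.lt_iff.2 hij
    have h4 := h.lt_iff.2 hjk
    rw [blockKey_lt_iff] at h3 h4
    have h5 := h.eq_min_of_adjacent hr hj
    have h6 := hr (π i)
    have h7 := hr (π j)
    have hmax : ∀ w, r w = r (π j) → w ≤ π j := by
      intro w hw
      by_contra! hlt
      have w1 : π.symm w < j := by
        rw [← π.symm_apply_apply j, h.symm_lt_iff, blockKey_lt_iff]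
        grind
      have w2 : i < π.symm w := by
        rw [← π.symm_apply_apply i, h.symm_lt_iff, blockKey_lt_iff]
        grind
      rw [Fin.lt_def] at w1 w2
      omega
    have := hmax (π k)
    exact he ⟨π k, π j, by grind, by grind, h2, hmax⟩

/-! ### Recovering the partition from a permutation -/

/-- Between two consecutive left-to-right minima an `a-bc`-avoiding permutation decreases. -/
theorem lt_of_avoids_a_bc {n : ℕ} {π : Equiv.Perm (Fin n)} (ha : GenPattern.a_bc.Avoids π)
    {p i : Fin n} (hpi : p < i) {j : Fin n} (hij : i < j) (hp : ∀ k ≤ j, π p ≤ π k) :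
    π j < π i := by
  rw [avoids_a_bc_iff] at ha
  have key : ∀ d : ℕ, ∀ j : Fin n, (j : ℕ) = i + 1 + d → (∀ k ≤ j, π p ≤ π k) → π j < π i := by
    intro d
    induction d with
    | zero =>
      intro j hj hp
      by_contra! hlt
      have hlt' : i < j := by rw [Fin.lt_def]; omega
      have h1 := (hp i hlt'.le).lt_of_ne (π.injective.ne hpi.ne)
      exact ha p i j hpi hj ⟨h1, hlt.lt_of_ne (π.injective.ne hlt'.ne)⟩
    | succ d ih =>
      intro j hj hp
      let k : Fin n := ⟨i + 1 + d, by omega⟩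
      have hk : (k : ℕ) = i + 1 + d := rfl
      have hkj : k < j := by rw [Fin.lt_def]; omega
      have hpk : p < k := by rw [Fin.lt_def] at hpi ⊢; omega
      have h1 := ih k hk fun l hl => hp l (hl.trans hkj.le)
      refine lt_trans ?_ h1
      by_contra! hlt
      have h2 := (hp k hkj.le).lt_of_ne (π.injective.ne hpk.ne)
      exact ha p k j hpk (by omega) ⟨h2, hlt.lt_of_ne (π.injective.ne hkj.ne)⟩
  rw [Fin.lt_def] at hij
  exact key (j - i - 1) j (by omega) hp

/-- Blocks are the stretches starting at left-to-right minima: `r v` is the running minimum at `v`,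
and avoidance makes the rest of each stretch decrease. -/
theorem exists_lists_of_avoids_a_bc {n : ℕ} {π : Equiv.Perm (Fin n)}
    (ha : GenPattern.a_bc.Avoids π) : ∃ r, IsMinMap r ∧ ListsBlocks π r := by
  have hex : ∀ v, ∃ m, IsLeast {w | π.symm w ≤ π.symm v} m := fun v => by
    obtain ⟨m, hm, hmin⟩ := Set.exists_min_image {w | π.symm w ≤ π.symm v} id (Set.toFinite _)
      ⟨v, le_refl (π.symm v)⟩
    exact ⟨m, hm, hmin⟩
  choose r hr using hex
  have hmem : ∀ v, π.symm (r v) ≤ π.symm v := fun v => (hr v).1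
  have hle : ∀ v w, π.symm w ≤ π.symm v → r v ≤ w := fun v w h => (hr v).2 h
  have hmin : IsMinMap r := fun v =>
    ⟨hle v v le_rfl, le_antisymm (hle _ _ le_rfl) (hle _ _ ((hmem _).trans (hmem _)))⟩
  refine ⟨r, hmin, fun i j hij => ?_⟩
  simp only [Function.comp_apply]
  rw [blockKey_lt_iff]
  have h1 : r (π j) ≤ r (π i) := hle _ _ ((hmem _).trans (by simpa using hij.le))
  rcases h1.lt_or_eq with h | h
  · exact Or.inl h
  · refine Or.inr ⟨h, ?_, ?_⟩
    · intro h'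
      have := hmem (π i)
      rw [← h, h', π.symm_apply_apply, π.symm_apply_apply] at this
      exact absurd this hij.not_ge
    · by_cases hi : r (π i) = π i
      · exact Or.inl hi
      · refine Or.inr (lt_of_avoids_a_bc ha (p := π.symm (r (π i))) ?_ hij ?_)
        · have := hmem (π i)
          rw [π.symm_apply_apply] at this
          refine this.lt_of_ne fun h' => hi ?_
          rwa [Equiv.symm_apply_eq] at h'
        · intro k hk
          rw [π.apply_symm_apply, ← h]
          exact hle _ _ (by simpa using hk)

theorem card_avoiders_eq (n : ℕ) :
    Nat.card (avoiders n {GenPattern.a_bc, GenPattern.ab_c}) =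
      Nat.card {r : Fin n → Fin n // IsMinMap r ∧ ¬ HasEnclosure r} := by
  choose f hf using fun r : Fin n → Fin n => ListsBlocks.exists_lists r
  symm
  refine Nat.card_eq_of_bijective
    (fun r : {r : Fin n → Fin n // IsMinMap r ∧ ¬ HasEnclosure r} =>
      (⟨f r.1, (mem_avoiders_iff _).2 ⟨(hf r.1).avoids_a_bc r.2.1,
        ((hf r.1).avoids_ab_c_iff r.2.1).2 r.2.2⟩⟩ :
        avoiders n {GenPattern.a_bc, GenPattern.ab_c})) ⟨?_, ?_⟩
  · intro r s h
    have h' : f r.1 = f s.1 := congrArg Subtype.val h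
    exact Subtype.ext ((hf r.1).map_unique (h' ▸ hf s.1) r.2.1 s.2.1)
  · rintro ⟨π, hπ⟩
    rw [mem_avoiders_iff] at hπ
    obtain ⟨r, hr, hl⟩ := exists_lists_of_avoids_a_bc hπ.1
    exact ⟨⟨r, hr, (hl.avoids_ab_c_iff hr).1 hπ.2⟩, Subtype.ext ((hf r).perm_unique hl)⟩

theorem mainTheorem4 (n : ℕ) :
    Nonempty (nonOverlappingPartitions n ≃ avoiders n {GenPattern.a_bc, GenPattern.ab_c}) ∧
      Nat.card (avoiders n {GenPattern.a_bc, GenPattern.ab_c}) = besselNumber n := by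
  have h : Nat.card (avoiders n {GenPattern.a_bc, GenPattern.ab_c}) = besselNumber n := by
    rw [card_avoiders_eq, besselNumber_eq, card_not_hasOverlap_eq_card_not_hasEnclosure]
  -- The correspondence is deduced from the equality of the two finite cardinalities.
  exact ⟨Finite.card_eq.1 h.symm, h⟩
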